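/- Let $n\in\mathbb N$, $G=\mathrm{GL}(n,\mathbb C)$, $\mathcal G=\mathfrak{gl}(n,\mathbb C)$, $\langle X,Y\rangle=\operatorname{tr}(XY)$, and let $\mathfrak M=G\times\mathcal G$, a complex manifold with points $(g,L)$, with algebra $\mathrm{Hol}(\mathfrak M)$ of holomorphic functions. Let $X_>$ and $X_<$ be the strictly upper and strictly lower triangular parts of $X\in\mathcal G$, and put $r(X)=\tfrac12(X_>-X_<)$, $r_\pm=r\pm\tfrac12\mathrm{id}$. For $F\in\mathrm{Hol}(\mathfrak M)$ define the $\mathcal G$-valued functions $\nabla_1F,\nabla_1'F,d_2F$ by $$\langle\nabla_1F(g,L),X\rangle=\tfrac{d}{dz}\Big|_{z=0}F(e^{zX}g,L),\quad \langle\nabla_1'F(g,L),X\rangle=\tfrac{d}{dz}\Big|_{z=0}F(ge^{zX},L),\quad \langle d_2F(g,L),X\rangle=\tfrac{d}{dz}\Big|_{z=0}F(g,L+zX)$$ for all $X\in\mathcal G$ ($z\in\mathbb C$), and put $\nabla_2F=L\,d_2F$, $\nabla_2'F=(d_2F)\,L$. For $F,H\in\mathrm{Hol}(\mathfrak M)$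 define $$\{F,H\}_1=\langle\nabla_1F,d_2H\rangle-\langle\nabla_1H,d_2F\rangle+\langle L,[d_2F,d_2H]\rangle,$$ $$\begin{aligned}\{F,H\}_2={}&\langle r\nabla_1F,\nabla_1H\rangle-\langle r\nabla_1'F,\nabla_1'H\rangle+\langle\nabla_2F-\nabla_2'F,\;r_+\nabla_2'H-r_-\nabla_2H\rangle\\&+\langle\nabla_1F,\;r_+\nabla_2'H-r_-\nabla_2H\rangle-\langle\nabla_1H,\;r_+\nabla_2'F-r_-\nabla_2F\rangle.\end{aligned}$$ **Theorem.** There is a unique holomorphic vector field $W$ on $\mathfrak M$ whose integral curve through each initial value $(g,L)$ is $\phi_z(g,L)=(g,L+z\mathbf 1_n)$, $z\in\mathbb C$. The first bracket is the Lie derivative of the second one along $W$: for all $F,H\in\mathrm{Hol}(\mathfrak M)$, $$W[\{F,H\}_2]-\{W[F],H\}_2-\{F,W[H]\}_2=\{F,H\}_1,$$ where $W[F]$ is the derivative of $F$ along $W$. The two brackets are compatible Poisson brackets: $\{\ ,\ \}_1$, $\{\ ,\ \}_2$ and every linear combination $x\{\ ,\ \}_1+y\{\ ,\ \}_2$ with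 $x,y\in\mathbb C$ are Poisson brackets on $\mathrm{Hol}(\mathfrak M)$, i.e. bilinear antisymmetric maps $\mathrm{Hol}(\mathfrak M)\times\mathrm{Hol}(\mathfrak M)\to\mathrm{Hol}(\mathfrak M)$ that are derivations in each argument and satisfy the Jacobi identity. -/

import Mathlib

namespace BiHam

noncomputable section

open Matrix

/-- The Lie algebra `gl(n, ℂ)` of all complex `n × n` matrices. -/
abbrev Mat (n : ℕ) : Type := Matrix (Fin n) (Fin n) ℂ

/-- The complex manifold `M = GL(n, ℂ) × gl(n, ℂ)`, with points `(g, L)`. -/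
abbrev Phase (n : ℕ) : Type := GL (Fin n) ℂ × Mat n

/-! ### The complex structure of `M`

`M` is an open submanifold of the complex vector space `gl(n, ℂ) × gl(n, ℂ)`, through the
inclusion `coords`, whose image is `domain n`. Tangent vectors to `M` are thus elements of
`gl(n, ℂ) × gl(n, ℂ)`. -/

/-- The inclusion of `M` in `gl(n, ℂ) × gl(n, ℂ)`. -/
def coords {n : ℕ} (p : Phase n) : Mat n × Mat n := ((p.1 : Mat n), p.2)

/-- The image of `M` in `gl(n, ℂ) × gl(n, ℂ)`. -/
def domain (n : ℕ) : Set (Mat n × Mat n) := {x | IsUnit x.1}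

open Classical in
/-- A function on `M`, regarded as a function on the open set `domain n`
(and given the irrelevant value `0` outside of it). -/
def extend {n : ℕ} {E : Type*} [Zero E] (F : Phase n → E) (x : Mat n × Mat n) : E :=
  if h : IsUnit x.1 then F (h.unit, x.2) else 0

/-- Holomorphic functions on `M` (with values in a complex vector space). -/
def IsHolomorphic {n : ℕ} {E : Type*} [AddCommGroup E] [Module ℂ E] [TopologicalSpace E]
    (F : Phase n → E) : Prop :=
  DifferentiableOn ℂ (extend F) (domain n)

/-! ### The trace form, and the operators `r` and `r_±` on `gl(n, ℂ)` -/

/-- The trace form `⟨X, Y⟩ = tr (X Y)`. -/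
def pairing {n : ℕ} (X Y : Mat n) : ℂ := (X * Y).trace

/-- The strictly upper triangular part of a matrix. -/
def upperPart {n : ℕ} (X : Mat n) : Mat n := Matrix.of fun i j => if i < j then X i j else 0

/-- The strictly lower triangular part of a matrix. -/
def lowerPart {n : ℕ} (X : Mat n) : Mat n := Matrix.of fun i j => if j < i then X i j else 0

/-- `r(X) = (X_> - X_<) / 2`. -/
def r {n : ℕ} (X : Mat n) : Mat n := (1 / 2 : ℂ) • (upperPart X - lowerPart X)

/-- `r_+ = r + id / 2`. -/
def rPlus {n : ℕ} (X : Mat n) : Mat n := r X + (1 / 2 : ℂ) • X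

/-- `r_- = r - id / 2`. -/
def rMinus {n : ℕ} (X : Mat n) : Mat n := r X - (1 / 2 : ℂ) • X

/-! ### Derivatives of functions on `M` -/

/-- The exponential of a matrix, as an element of `GL(n, ℂ)`. -/
def expGL {n : ℕ} (X : Mat n) : GL (Fin n) ℂ := (Matrix.isUnit_exp X).unit

/-- For a linear functional `ℓ` on `gl(n, ℂ)`, the matrix `Y` such that `⟨Y, X⟩ = ℓ X` for
all `X` (see `pairing_represent`). -/
def represent {n : ℕ} (ℓ : Mat n → ℂ) : Mat n := Matrix.of fun i j => ℓ (Matrix.single j i 1)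

/-- `⟨∇₁F(g, L), X⟩ = d/dz F(e^{zX} g, L)` at `z = 0`. -/
def nabla1 {n : ℕ} (F : Phase n → ℂ) (p : Phase n) : Mat n :=
  represent fun X => deriv (fun z : ℂ => F (expGL (z • X) * p.1, p.2)) 0

/-- `⟨∇₁'F(g, L), X⟩ = d/dz F(g e^{zX}, L)` at `z = 0`. -/
def nabla1' {n : ℕ} (F : Phase n → ℂ) (p : Phase n) : Mat n :=
  represent fun X => deriv (fun z : ℂ => F (p.1 * expGL (z • X), p.2)) 0

/-- `⟨d₂F(g, L), X⟩ = d/dz F(g, L + z X)` at `z = 0`. -/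
def d2 {n : ℕ} (F : Phase n → ℂ) (p : Phase n) : Mat n :=
  represent fun X => deriv (fun z : ℂ => F (p.1, p.2 + z • X)) 0

/-- `∇₂F = L d₂F`. -/
def nabla2 {n : ℕ} (F : Phase n → ℂ) (p : Phase n) : Mat n := p.2 * d2 F p

/-- `∇₂'F = (d₂F) L`. -/
def nabla2' {n : ℕ} (F : Phase n → ℂ) (p : Phase n) : Mat n := d2 F p * p.2

/-! ### The two brackets -/

/-- The first bracket (the canonical one of the cotangent bundle of `GL(n, ℂ)`). -/
def bracket1 {n : ℕ} (F H : Phase n → ℂ) (p : Phase n) : ℂ :=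
  pairing (nabla1 F p) (d2 H p) - pairing (nabla1 H p) (d2 F p)
    + pairing p.2 (d2 F p * d2 H p - d2 H p * d2 F p)

/-- The second bracket. -/
def bracket2 {n : ℕ} (F H : Phase n → ℂ) (p : Phase n) : ℂ :=
  pairing (r (nabla1 F p)) (nabla1 H p) - pairing (r (nabla1' F p)) (nabla1' H p)
    + pairing (nabla2 F p - nabla2' F p) (rPlus (nabla2' H p) - rMinus (nabla2 H p))
    + pairing (nabla1 F p) (rPlus (nabla2' H p) - rMinus (nabla2 H p))
    - pairing (nabla1 H p) (rPlus (nabla2' F p) - rMinus (nabla2 F p))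

/-! ### Poisson brackets, vector fields, Lie derivatives -/

/-- `B` is a Poisson bracket on the algebra of holomorphic functions on `M`: it maps pairs of
holomorphic functions to holomorphic functions, and on them it is bilinear, antisymmetric, a
derivation in each argument, and satisfies the Jacobi identity. -/
structure IsPoissonBracket {n : ℕ}
    (B : (Phase n → ℂ) → (Phase n → ℂ) → (Phase n → ℂ)) : Prop where
  holomorphic : ∀ F H, IsHolomorphic F → IsHolomorphic H → IsHolomorphic (B F H)
  antisymm : ∀ F H, IsHolomorphic F → IsHolomorphic H → B F H = -B H F
  add_left : ∀ F G H, IsHolomorphic F → IsHolomorphic G → IsHolomorphic H →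
    B (F + G) H = B F H + B G H
  smul_left : ∀ (c : ℂ) (F H), IsHolomorphic F → IsHolomorphic H → B (c • F) H = c • B F H
  leibniz : ∀ F G H, IsHolomorphic F → IsHolomorphic G → IsHolomorphic H →
    B (F * G) H = F * B G H + B F H * G
  jacobi : ∀ F G H, IsHolomorphic F → IsHolomorphic G → IsHolomorphic H →
    B F (B G H) + B G (B H F) + B H (B F G) = 0

/-- Two Poisson brackets are compatible if all their linear combinations are Poisson brackets. -/
def Compatible {n : ℕ} (B₁ B₂ : (Phase n → ℂ) → (Phase n → ℂ) → (Phase n → ℂ)) : Prop :=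
  IsPoissonBracket B₁ ∧ IsPoissonBracket B₂ ∧
    ∀ x y : ℂ, IsPoissonBracket fun F H => x • B₁ F H + y • B₂ F H

/-- The derivative `W[F]` of the function `F` along the vector field `W`. -/
def derivAlong {n : ℕ} (W : Phase n → Mat n × Mat n) (F : Phase n → ℂ) (p : Phase n) : ℂ :=
  fderiv ℂ (extend F) (coords p) (W p)

/-- The Lie derivative of a bracket along the vector field `W`:
`{F, H}^W = W[{F, H}] - {W[F], H} - {F, W[H]}`. -/
def lieDerivBracket {n : ℕ} (W : Phase n → Mat n × Mat n)
    (B : (Phase n → ℂ) → (Phase n → ℂ) → (Phase n → ℂ)) (F H : Phase n → ℂ) : Phase n → ℂ :=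
  derivAlong W (B F H) - B (derivAlong W F) H - B F (derivAlong W H)

/-- `γ : ℂ → M` is the integral curve of `W` (in complex time) with initial value `p`. -/
def IsIntegralCurveFrom {n : ℕ} (W : Phase n → Mat n × Mat n) (γ : ℂ → Phase n)
    (p : Phase n) : Prop :=
  γ 0 = p ∧ ∀ z : ℂ, HasDerivAt (fun w => coords (γ w)) (W (γ z)) z

/-- The shift `φ_z (g, L) = (g, L + z 1)`. -/
def shift {n : ℕ} (z : ℂ) (p : Phase n) : Phase n := (p.1, p.2 + z • (1 : Mat n))

/-- `W` is a holomorphic vector field on `M` whose integral curve through any initial value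
`p` is `z ↦ φ_z p`. -/
def GeneratesShift {n : ℕ} (W : Phase n → Mat n × Mat n) : Prop :=
  IsHolomorphic W ∧ ∀ p, IsIntegralCurveFrom W (fun z => shift z p) p

/-! ### The derivatives satisfy their defining relations -/

theorem pairing_represent {n : ℕ} (ℓ : Mat n →ₗ[ℂ] ℂ) (X : Mat n) :
    pairing (represent ℓ) X = ℓ X := by
  conv_rhs => rw [Matrix.matrix_eq_sum_single X]
  simp only [pairing, represent, Matrix.trace, Matrix.diag, Matrix.mul_apply, map_sum,
    Matrix.of_apply]
  rw [Finset.sum_comm]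
  refine Finset.sum_congr rfl fun i _ => Finset.sum_congr rfl fun j _ => ?_
  have : Matrix.single i j (X i j) = X i j • (Matrix.single i j 1 : Mat n) := by
    simp [Matrix.smul_single]
  rw [this, map_smul, smul_eq_mul, mul_comm]

@[simp] theorem extend_coords {n : ℕ} {E : Type*} [Zero E] (F : Phase n → E) (p : Phase n) :
    extend F (coords p) = F p := by
  have h : IsUnit (coords p).1 := p.1.isUnit
  have h2 : h.unit = p.1 := Units.ext rfl
  rw [extend, dif_pos h, h2]
  rfl

section

attribute [local instance] Matrix.normedAddCommGroup Matrix.normedSpace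

theorem isOpen_domain (n : ℕ) : IsOpen (domain n) := by
  have h : domain n = {x : Mat n × Mat n | x.1.det ≠ 0} := by
    ext x
    simp [domain, Matrix.isUnit_iff_isUnit_det]
  rw [h]
  exact isOpen_ne_fun (Continuous.matrix_det continuous_fst) continuous_const

/-- The chain rule along a curve in `M`. -/
theorem IsHolomorphic.hasDerivAt_comp {n : ℕ} {F : Phase n → ℂ} (hF : IsHolomorphic F)
    {γ : ℂ → Phase n} {v : Mat n × Mat n} {z : ℂ}
    (hγ : HasDerivAt (fun w => coords (γ w)) v z) :
    HasDerivAt (fun w => F (γ w)) (fderiv ℂ (extend F) (coords (γ z)) v) z := by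
  have hd : DifferentiableAt ℂ (extend F) (coords (γ z)) :=
    (hF _ (γ z).1.isUnit).differentiableAt ((isOpen_domain n).mem_nhds (γ z).1.isUnit)
  have h := hd.hasFDerivAt.comp_hasDerivAt z hγ
  have e : extend F ∘ (fun w => coords (γ w)) = fun w => F (γ w) := by
    ext w
    simp
  rw [e] at h
  exact h

theorem hasDerivAt_coe_expGL {n : ℕ} (X : Mat n) :
    HasDerivAt (fun z : ℂ => (expGL (z • X) : Mat n)) X 0 := by
  have h : HasDerivAt (fun z : ℂ => NormedSpace.exp (z • X)) X 0 := by
    open scoped Matrix.Norms.Operator in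
    have := hasDerivAt_exp_smul_const (𝕂 := ℂ) X (0 : ℂ)
    simp only [zero_smul, NormedSpace.exp_zero, one_mul] at this
    exact this
  exact h

theorem expGL_zero {n : ℕ} (X : Mat n) : expGL ((0 : ℂ) • X) = 1 := by
  apply Units.ext
  simp [expGL]

theorem hasDerivAt_nabla1 {n : ℕ} {F : Phase n → ℂ} (hF : IsHolomorphic F) (p : Phase n)
    (X : Mat n) :
    HasDerivAt (fun z : ℂ => F (expGL (z • X) * p.1, p.2)) (pairing (nabla1 F p) X) 0 := by
  have key : ∀ Y : Mat n, HasDerivAt (fun z : ℂ => F (expGL (z • Y) * p.1, p.2))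
      (fderiv ℂ (extend F) (coords p) (Y * (p.1 : Mat n), 0)) 0 := by
    intro Y
    have h1 : HasDerivAt (fun z : ℂ => (expGL (z • Y) : Mat n) * (p.1 : Mat n))
        (Y * (p.1 : Mat n)) 0 := by
      open scoped Matrix.Norms.Operator in
      exact (hasDerivAt_coe_expGL Y).mul_const (p.1 : Mat n)
    have h := hF.hasDerivAt_comp (γ := fun z : ℂ => (expGL (z • Y) * p.1, p.2))
      (h1.prodMk (hasDerivAt_const (0 : ℂ) p.2))
    simp only [expGL_zero, one_mul] at h
    exact h
  have e : nabla1 F p = represent (((fderiv ℂ (extend F) (coords p)).toLinearMap ∘ₗ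
      LinearMap.inl ℂ (Mat n) (Mat n)) ∘ₗ LinearMap.mulRight ℂ (p.1 : Mat n)) := by
    ext i j
    exact (key _).deriv
  rw [e, pairing_represent]
  exact key X

theorem hasDerivAt_nabla1' {n : ℕ} {F : Phase n → ℂ} (hF : IsHolomorphic F) (p : Phase n)
    (X : Mat n) :
    HasDerivAt (fun z : ℂ => F (p.1 * expGL (z • X), p.2)) (pairing (nabla1' F p) X) 0 := by
  have key : ∀ Y : Mat n, HasDerivAt (fun z : ℂ => F (p.1 * expGL (z • Y), p.2))
      (fderiv ℂ (extend F) (coords p) ((p.1 : Mat n) * Y, 0)) 0 := by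
    intro Y
    have h1 : HasDerivAt (fun z : ℂ => (p.1 : Mat n) * (expGL (z • Y) : Mat n))
        ((p.1 : Mat n) * Y) 0 := by
      open scoped Matrix.Norms.Operator in
      exact (hasDerivAt_coe_expGL Y).const_mul (p.1 : Mat n)
    have h := hF.hasDerivAt_comp (γ := fun z : ℂ => (p.1 * expGL (z • Y), p.2))
      (h1.prodMk (hasDerivAt_const (0 : ℂ) p.2))
    simp only [expGL_zero, mul_one] at h
    exact h
  have e : nabla1' F p = represent (((fderiv ℂ (extend F) (coords p)).toLinearMap ∘ₗ
      LinearMap.inl ℂ (Mat n) (Mat n)) ∘ₗ LinearMap.mulLeft ℂ (p.1 : Mat n)) := by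
    ext i j
    exact (key _).deriv
  rw [e, pairing_represent]
  exact key X

theorem hasDerivAt_d2 {n : ℕ} {F : Phase n → ℂ} (hF : IsHolomorphic F) (p : Phase n)
    (X : Mat n) :
    HasDerivAt (fun z : ℂ => F (p.1, p.2 + z • X)) (pairing (d2 F p) X) 0 := by
  have key : ∀ Y : Mat n, HasDerivAt (fun z : ℂ => F (p.1, p.2 + z • Y))
      (fderiv ℂ (extend F) (coords p) (0, Y)) 0 := by
    intro Y
    have h1 : HasDerivAt (fun z : ℂ => p.2 + z • Y) Y 0 := by
      have h0 := ((hasDerivAt_id (0 : ℂ)).smul_const Y).const_add p.2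
      rw [one_smul] at h0
      exact h0
    have h := hF.hasDerivAt_comp (γ := fun z : ℂ => (p.1, p.2 + z • Y))
      ((hasDerivAt_const (0 : ℂ) (p.1 : Mat n)).prodMk h1)
    simp only [zero_smul, add_zero] at h
    exact h
  have e : d2 F p = represent ((fderiv ℂ (extend F) (coords p)).toLinearMap ∘ₗ
      LinearMap.inr ℂ (Mat n) (Mat n)) := by
    ext i j
    exact (key _).deriv
  rw [e, pairing_represent]
  exact key X

end

end

end BiHam

/-! Let A and B be the matrices of the two components of dF for the trace form. Then ∇₁F = gA, ∇₁'F
= Ag and d₂F = B. Since r_+(BL) - r_-(LB) = r([B, L]) + (LB + BL)/2, setting μ = gA + [L, B] gathers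
the r-terms of the second bracket into ⟨rμ, μ'⟩ - ⟨r(Ag), A'g⟩. The rest is free of r. The first
bracket only adds xB to (y/2)(LB + BL) and xL to (y/2)L², so the whole pencil is one bivector with
parameters x and y (`bivector_eq_brackets`), and it is enough to treat that bivector.

Linearity and the Leibniz rule follow from writing the bracket as dF applied to the Hamiltonian
vector of H. In the Jacobi sum the second derivatives cancel by symmetry. What remains is a trace
identity in three covectors (`bivectorDeriv_cyclic`), which is y² times the difference of the
modified Yang–Baxter equations for the μ's and for the Ag's.

The shift is generated by the constant field W = (0, 1). The Lie derivative of the second bracket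
therefore only differentiates the coefficients of the bivector. Adding a multiple of 1 to L does not
change μ, while LB + BL and L² produce exactly the first bracket (`bivectorDeriv_shift`).

The analytic input is that derivatives of holomorphic functions of several variables are again
holomorphic. -/

namespace BiHam

/-! ### Derivatives of holomorphic functions of several variables -/

section SeveralComplexVariables

open Metric MeasureTheory

variable {V : Type*} [NormedAddCommGroup V] [NormedSpace ℂ V] [FiniteDimensional ℂ V]

/-- Cauchy's formula on the complex line through x in the direction v writes the directional
derivative as a circle integral of values of f. This integral can be differentiated in x under the
integral sign. -/
theorem differentiableAt_fderiv_apply {f : V → ℂ} {U : Set V} (hU : IsOpen U)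
    (hf : DifferentiableOn ℂ f U) {x₀ : V} (hx₀ : x₀ ∈ U) (v : V) :
    DifferentiableAt ℂ (fun x => fderiv ℂ f x v) x₀ := by
  have hc : ContinuousAt f x₀ := (hf.differentiableAt (hU.mem_nhds hx₀)).continuousAt
  obtain ⟨ε, hε, hball⟩ : ∃ ε > 0, ball x₀ ε ⊆ U ∩ f ⁻¹' ball (f x₀) 1 :=
    Metric.mem_nhds_iff.1 (Filter.inter_mem (hU.mem_nhds hx₀) (hc (ball_mem_nhds _ one_pos)))
  -- Three nested balls: x ranges over radius δ, the circles x + zv stay within 2δ, and a further δ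
  -- is left for the Cauchy estimate.
  obtain ⟨δ, hδ, rfl⟩ : ∃ δ > 0, ε = 3 * δ := ⟨ε / 3, by positivity, by ring⟩
  obtain ⟨ρ, hρ, hρv⟩ : ∃ ρ > 0, ρ * ‖v‖ < δ := by
    refine ⟨δ / (‖v‖ + 1), by positivity, ?_⟩
    rw [div_mul_eq_mul_div, div_lt_iff₀ (by positivity)]
    nlinarith [norm_nonneg v]
  have hdiff : ∀ y ∈ ball x₀ (3 * δ), DifferentiableAt ℂ f y := fun y hy =>
    hf.differentiableAt (hU.mem_nhds (hball hy).1)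
  have hmem : ∀ x ∈ ball x₀ δ, ∀ z : ℂ, ‖z‖ ≤ ρ → x + z • v ∈ ball x₀ (2 * δ) := by
    intro x hx z hz
    rw [mem_ball, dist_eq_norm] at hx ⊢
    calc ‖x + z • v - x₀‖ = ‖(x - x₀) + z • v‖ := by congr 1; abel
      _ ≤ ‖x - x₀‖ + ‖z‖ * ‖v‖ := (norm_add_le _ _).trans (by rw [norm_smul])
      _ < 2 * δ := by nlinarith [mul_le_mul_of_nonneg_right hz (norm_nonneg v)]
  have hsub : ball x₀ (2 * δ) ⊆ ball x₀ (3 * δ) := ball_subset_ball (by linarith)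
  have hbound : ∀ y ∈ ball x₀ (2 * δ), ‖fderiv ℂ f y‖ ≤ 2 / δ := by
    intro y hy
    have hy3 : ball y δ ⊆ ball x₀ (3 * δ) := by
      refine ball_subset_ball' ?_
      rw [mem_ball] at hy
      linarith
    refine Complex.norm_fderiv_le_div_of_mapsTo_ball
      (fun z hz => (hdiff z (hy3 hz)).differentiableWithinAt) (fun z hz => ?_) hδ
    have h1 := (hball (hy3 hz)).2
    have h2 := (hball (hsub hy)).2
    simp only [Set.mem_preimage, mem_ball, mem_closedBall] at h1 h2 ⊢
    linarith [dist_triangle_right (f z) (f y) (f x₀)]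
  have hline : ∀ x (z : ℂ), HasDerivAt (fun w : ℂ => x + w • v) v z := fun x z => by
    simpa using ((hasDerivAt_id z).smul_const v).const_add x
  have hcauchy : ∀ x ∈ ball x₀ δ, fderiv ℂ f x v
      = (2 * Real.pi * Complex.I : ℂ)⁻¹ • ∮ z in C(0, ρ), ((z - 0) ^ 2)⁻¹ • f (x + z • v) := by
    intro x hx
    have hx3 : x ∈ ball x₀ (3 * δ) := ball_subset_ball (by linarith) hx
    have hd : DifferentiableOn ℂ (fun z : ℂ => f (x + z • v))
        ((fun z : ℂ => x + z • v) ⁻¹' ball x₀ (3 * δ)) := fun z hz =>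
      ((hdiff _ hz).hasFDerivAt.comp_hasDerivAt z (hline x z)).differentiableAt.differentiableWithinAt
    have ho : IsOpen ((fun z : ℂ => x + z • v) ⁻¹' ball x₀ (3 * δ)) :=
      isOpen_ball.preimage (by fun_prop)
    have h := Complex.two_pi_I_inv_smul_circleIntegral_sub_sq_inv_smul_of_differentiable ho
      (c := 0) (R := ρ) (fun z hz => hsub (hmem x hx z (by simpa using hz))) hd
      (mem_ball_self hρ)
    rw [h]
    have hx' : DifferentiableAt ℂ f (x + (0 : ℂ) • v) := by simpa using hdiff x hx3
    have := (hx'.hasFDerivAt.comp_hasDerivAt (0 : ℂ) (hline x 0)).deriv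
    simp only [zero_smul, add_zero] at this
    exact this.symm
  suffices h : DifferentiableAt ℂ
      (fun x => ∮ z in C(0, ρ), ((z - 0) ^ 2)⁻¹ • f (x + z • v)) x₀ by
    refine (h.const_smul (2 * Real.pi * Complex.I : ℂ)⁻¹).congr_of_eventuallyEq ?_
    filter_upwards [ball_mem_nhds x₀ hδ] with x hx using hcauchy x hx
  let c : ℝ → ℂ := fun θ => deriv (circleMap 0 ρ) θ * ((circleMap 0 ρ θ - 0) ^ 2)⁻¹
  have hne : ∀ θ, circleMap 0 ρ θ ≠ 0 := fun θ => circleMap_ne_center hρ.ne'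
  have hcc : Continuous c := by
    simp only [c, deriv_circleMap, sub_zero]
    exact ((continuous_circleMap 0 ρ).mul continuous_const).mul
      (((continuous_circleMap 0 ρ).pow 2).inv₀ fun θ => pow_ne_zero 2 (hne θ))
  have hnorm : ∀ θ, ‖circleMap 0 ρ θ‖ ≤ ρ := fun θ => by simp [abs_of_pos hρ]
  have hfc : ∀ x ∈ ball x₀ δ, Continuous fun θ => c θ • f (x + circleMap 0 ρ θ • v) := by
    intro x hx
    refine hcc.smul (continuous_iff_continuousAt.2 fun θ => ?_)
    refine ContinuousAt.comp (g := f)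
      (hdiff _ (hsub (hmem x hx _ (hnorm θ)))).continuousAt ?_
    exact ((continuous_circleMap 0 ρ).smul continuous_const |>.const_add x).continuousAt
  have key := intervalIntegral.hasFDerivAt_integral_of_dominated_of_fderiv_le
    (𝕜 := ℂ) (μ := volume) (a := 0) (b := 2 * Real.pi) (x₀ := x₀) (s := ball x₀ δ)
    (F := fun x θ => c θ • f (x + circleMap 0 ρ θ • v))
    (F' := fun x θ => c θ • fderiv ℂ f (x + circleMap 0 ρ θ • v))
    (bound := fun θ => ‖c θ‖ * (2 / δ)) (ball_mem_nhds x₀ hδ)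
    (by filter_upwards [ball_mem_nhds x₀ hδ] with x hx using (hfc x hx).aestronglyMeasurable)
    ((hfc x₀ (mem_ball_self hδ)).intervalIntegrable _ _)
    (by
      borelize V
      borelize (V →L[ℂ] ℂ)
      have : FiniteDimensional ℂ (V →L[ℂ] ℂ) := inferInstance
      have : ProperSpace (V →L[ℂ] ℂ) := FiniteDimensional.proper ℂ _
      refine (hcc.measurable.aestronglyMeasurable).smul ?_
      refine Measurable.aestronglyMeasurable ?_
      -- Continuity of the derivative is not yet known, but measurability holds for any function.
      exact (measurable_fderiv ℂ f).comp
        (((continuous_circleMap 0 ρ).smul continuous_const).const_add x₀).measurable)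
    (Filter.Eventually.of_forall fun θ _ x hx => by
      rw [norm_smul]
      exact mul_le_mul_of_nonneg_left (hbound _ (hmem x hx _ (hnorm θ))) (norm_nonneg _))
    ((hcc.norm.mul continuous_const).intervalIntegrable _ _)
    (Filter.Eventually.of_forall fun θ _ x hx => by
      refine HasFDerivAt.const_smul ?_ (c θ)
      have h1 := (hdiff _ (hsub (hmem x hx _ (hnorm θ)))).hasFDerivAt
      exact h1.comp x ((hasFDerivAt_id x).add_const (circleMap 0 ρ θ • v)))
  refine key.differentiableAt.congr_of_eventuallyEq (Filter.Eventually.of_forall fun x => ?_)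
  simp only [circleIntegral, c, smul_eq_mul, mul_assoc]

/-- The derivative of a holomorphic function of several variables is holomorphic. -/
theorem differentiableAt_fderiv {f : V → ℂ} {U : Set V} (hU : IsOpen U)
    (hf : DifferentiableOn ℂ f U) {x : V} (hx : x ∈ U) :
    DifferentiableAt ℂ (fderiv ℂ f) x := by
  have h := fun v => differentiableAt_fderiv_apply hU hf hx v
  let b := Module.finBasis ℂ V
  have e : fderiv ℂ f = fun y =>
      ∑ i, fderiv ℂ f y (b i) • LinearMap.toContinuousLinearMap (b.coord i) := by
    ext y w
    have hw := congrArg (fderiv ℂ f y) (b.sum_repr w)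
    simp only [map_sum, map_smul, smul_eq_mul] at hw
    rw [← hw]
    simp [mul_comm]
  rw [e]
  exact DifferentiableAt.fun_sum fun i _ => (h (b i)).smul_const _

/-- The second derivative of a holomorphic function of several variables is symmetric. -/
theorem fderiv_fderiv_apply_symm {f : V → ℂ} {U : Set V} (hU : IsOpen U)
    (hf : DifferentiableOn ℂ f U) {x : V} (hx : x ∈ U) (v w : V) :
    fderiv ℂ (fun y => fderiv ℂ f y v) x w = fderiv ℂ (fun y => fderiv ℂ f y w) x v := by
  have h := (differentiableAt_fderiv hU hf hx).hasFDerivAt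
  have e : ∀ u : V, HasFDerivAt (fun y => fderiv ℂ f y u)
      ((fderiv ℂ (fderiv ℂ f) x).flip u) x := fun u => by
    simpa using h.clm_apply (hasFDerivAt_const u x)
  rw [(e v).fderiv, (e w).fderiv]
  exact second_derivative_symmetric_of_eventually
    (Filter.eventually_of_mem (hU.mem_nhds hx) fun _ hy =>
      (hf.differentiableAt (hU.mem_nhds hy)).hasFDerivAt) h w v

end SeveralComplexVariables

noncomputable section

open Matrix

variable {n : ℕ}

/-! ### The operator r and the modified Yang–Baxter equation -/

theorem r_apply (X : Mat n) (i j : Fin n) :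
    r X i j = (1 / 2 : ℂ) * ((if i < j then 1 else 0) - (if j < i then 1 else 0)) * X i j := by
  simp only [r, upperPart, lowerPart, Matrix.smul_apply, Matrix.sub_apply, Matrix.of_apply,
    smul_eq_mul]
  split_ifs <;> ring

theorem r_add (X Y : Mat n) : r (X + Y) = r X + r Y := by
  ext i j; simp only [r_apply, Matrix.add_apply]; ring

theorem r_smul (c : ℂ) (X : Mat n) : r (c • X) = c • r X := by
  ext i j; simp only [r_apply, Matrix.smul_apply, smul_eq_mul]; ring

/-- The operator `r` as a linear map. -/
def rLin (n : ℕ) : Mat n →ₗ[ℂ] Mat n where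
  toFun := r
  map_add' := r_add
  map_smul' := r_smul

/-- The operator r multiplies the entry (i, j) by a sign factor that is odd under exchange of i and
j. -/
theorem trace_r_mul (X Y : Mat n) : (r X * Y).trace = -(X * r Y).trace := by
  simp only [Matrix.trace, Matrix.diag, Matrix.mul_apply, r_apply, ← Finset.sum_neg_distrib]
  refine Finset.sum_congr rfl fun i _ => Finset.sum_congr rfl fun j _ => ?_
  ring

set_option linter.unusedSimpArgs false in
/-- A form of the modified classical Yang–Baxter equation, before antisymmetrization. -/
theorem trace_r_mul_r_mul (X Y Z : Mat n) :
    (r X * (r Y * Z)).trace + (r X * (Y * r Z)).trace + (X * (r Y * r Z)).trace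
      = -(1 / 4) * (X * (Y * Z)).trace + 1 / 4 * ∑ i, X i i * Y i i * Z i i := by
  have hsum : ∑ i, X i i * Y i i * Z i i = ∑ i, ∑ j, ∑ k,
      (if i = j ∧ j = k then X i j * (Y j k * Z k i) else 0) := by
    refine Finset.sum_congr rfl fun i _ => ?_
    rw [Finset.sum_eq_single i, Finset.sum_eq_single i]
    · simp [mul_assoc]
    · intro k _ hk; simp [hk.symm]
    · simp
    · intro j _ hj; simp [hj.symm]
    · simp
  rw [hsum]
  simp only [Matrix.trace, Matrix.diag, Matrix.mul_apply, r_apply, Finset.mul_sum,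
    ← Finset.sum_add_distrib]
  refine Finset.sum_congr rfl fun i _ => Finset.sum_congr rfl fun j _ =>
    Finset.sum_congr rfl fun k _ => ?_
  -- Compare the coefficients of X i j * Y j k * Z k i. If a, b, c are the signs of j - i, k - j, i
  -- - k, then ab + bc + ca is -1, except that it is 0 when i = j = k. The diagonal sum corrects for
  -- this exception.
  rcases lt_trichotomy i j with h1 | h1 | h1 <;> rcases lt_trichotomy j k with h2 | h2 | h2 <;>
    rcases lt_trichotomy k i with h3 | h3 | h3 <;>
    first
    | (exfalso; omega)
    | (simp only [h1, h2, h3, h1.not_gt, h2.not_gt, h3.not_gt, h1.ne, h2.ne, h1.ne', h2.ne',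
        if_true, if_false, false_and, and_false]; ring1)
    | (subst h1; simp only [h2, h3, h2.not_gt, h3.not_gt, h2.ne, h2.ne', lt_irrefl,
        if_true, if_false, and_false]; ring1)
    | (subst h2; simp only [h1, h3, h1.not_gt, h3.not_gt, h1.ne, h1.ne', lt_irrefl,
        if_true, if_false, false_and]; ring1)
    | (subst h1; subst h2; simp only [lt_irrefl, if_true, if_false, and_self]; ring1)

/-- The modified classical Yang–Baxter equation for `r`, paired with a third matrix. -/
theorem modified_yang_baxter (X Y Z : Mat n) :
    (r X * (r Y * Z)).trace + (r X * (Y * r Z)).trace + (X * (r Y * r Z)).trace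
      - ((r Y * (r X * Z)).trace + (r Y * (X * r Z)).trace + (Y * (r X * r Z)).trace)
      -- The diagonal sum is symmetric in X and Y, so antisymmetrization removes it.
      = -(1 / 4) * ((X * (Y * Z)).trace - (Y * (X * Z)).trace) := by
  have e : ∑ i, Y i i * X i i * Z i i = ∑ i, X i i * Y i i * Z i i :=
    Finset.sum_congr rfl fun i _ => by ring
  rw [trace_r_mul_r_mul, trace_r_mul_r_mul, e]
  ring

/-! ### The bivector of the pencil and its Schouten identity -/

/-- The momentum of the left action of `GL(n, ℂ)`, by multiplication on `g` and by conjugation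
on `L`. -/
def momentum (g L A B : Mat n) : Mat n := g * A + L * B - B * L

/-- Half of the anticommutator of `y L + x 1` and `B`. -/
def halfAnticomm (x y : ℂ) (L B : Mat n) : Mat n := (y / 2) • (L * B + B * L) + x • B

/-- The bivector `x P₁ + y P₂` of the pencil at `(g, L)`, on the covectors `(A, B)`, `(A', B')`. -/
def bivector (x y : ℂ) (g L A B A' B' : Mat n) : ℂ :=
  y * (r (momentum g L A B) * momentum g L A' B').trace - y * (r (A * g) * (A' * g)).trace
    + (g * A * halfAnticomm x y L B').trace - (g * A' * halfAnticomm x y L B).trace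
    + (((y / 2) • (L * L) + x • L) * (B * B' - B' * B)).trace

/-- The derivative of `bivector` with respect to `(g, L)`, in the direction of `(v, w)`. -/
def bivectorDeriv (x y : ℂ) (g L v w A B A' B' : Mat n) : ℂ :=
  y * ((r (momentum v w A B) * momentum g L A' B').trace
      + (r (momentum g L A B) * momentum v w A' B').trace)
    - y * ((r (A * v) * (A' * g)).trace + (r (A * g) * (A' * v)).trace)
    + ((v * A * halfAnticomm x y L B').trace + (y / 2) * (g * A * (w * B' + B' * w)).trace)
    - ((v * A' * halfAnticomm x y L B).trace + (y / 2) * (g * A' * (w * B + B * w)).trace)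
    + (((y / 2) • (w * L + L * w) + x • w) * (B * B' - B' * B)).trace

/-- The first component of the Hamiltonian vector of a covector. -/
def hamVec₁ (x y : ℂ) (g L A B : Mat n) : Mat n :=
  halfAnticomm x y L B * g - y • (r (momentum g L A B) * g) + y • (g * r (A * g))

/-- The second component of the Hamiltonian vector of a covector. -/
def hamVec₂ (x y : ℂ) (g L A B : Mat n) : Mat n :=
  B * ((y / 2) • (L * L) + x • L) - ((y / 2) • (L * L) + x • L) * B
    - halfAnticomm x y L (g * A)
    - y • (r (momentum g L A B) * L - L * r (momentum g L A B))

/-! Cyclic rotations of a product under the trace, bringing a chosen factor `c` to the front. -/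

section Cyclic

variable (c a b d e f k : Mat n)

theorem trace_rot₁ : (a * c).trace = (c * a).trace := Matrix.trace_mul_comm a c
theorem trace_rot₁' : (a * (c * k)).trace = (c * (k * a)).trace := by
  rw [Matrix.trace_mul_comm, mul_assoc]
theorem trace_rot₂ : (a * (b * c)).trace = (c * (a * b)).trace := by
  rw [← mul_assoc, trace_rot₁]
theorem trace_rot₂' : (a * (b * (c * k))).trace = (c * (k * (a * b))).trace := by
  rw [← mul_assoc, trace_rot₁']
theorem trace_rot₃ : (a * (b * (d * c))).trace = (c * (a * (b * d))).trace := by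
  rw [← mul_assoc, trace_rot₂, mul_assoc]
theorem trace_rot₃' : (a * (b * (d * (c * k)))).trace = (c * (k * (a * (b * d)))).trace := by
  rw [← mul_assoc, trace_rot₂', mul_assoc]
theorem trace_rot₄ : (a * (b * (d * (e * c)))).trace = (c * (a * (b * (d * e)))).trace := by
  rw [← mul_assoc, trace_rot₃, mul_assoc]
theorem trace_rot₄' :
    (a * (b * (d * (e * (c * k))))).trace = (c * (k * (a * (b * (d * e))))).trace := by
  rw [← mul_assoc, trace_rot₃', mul_assoc]
theorem trace_rot₅ :
    (a * (b * (d * (e * (f * c))))).trace = (c * (a * (b * (d * (e * f))))).trace := by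
  rw [← mul_assoc, trace_rot₄, mul_assoc]

end Cyclic

/-- Skewness of r and cyclicity of the trace isolate A and B, and their cofactors are the components
of the Hamiltonian vector of (A', B'). -/
theorem bivector_eq_trace_hamVec (x y : ℂ) (g L A B A' B' : Mat n) :
    bivector x y g L A B A' B'
      = (A * hamVec₁ x y g L A' B').trace + (B * hamVec₂ x y g L A' B').trace := by
  simp only [bivector, hamVec₁, hamVec₂, trace_r_mul]
  generalize r (momentum g L A' B') = R
  generalize r (A' * g) = Q
  simp only [momentum, halfAnticomm, mul_add, add_mul, mul_sub, sub_mul, smul_mul_assoc,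
    mul_smul_comm, smul_add, smul_sub, trace_add, trace_sub, trace_smul, smul_eq_mul,
    mul_assoc]
  simp only [
    trace_rot₁' A, trace_rot₁' B, trace_rot₂ B, trace_rot₂' B, trace_rot₃ B, mul_assoc]
  ring

/-- The bracket `x { , }₁ + y { , }₂` in terms of the bivector. -/
theorem bivector_eq_brackets (x y : ℂ) (g L A B A' B' : Mat n) :
    bivector x y g L A B A' B'
      = x * (((g * A) * B').trace - ((g * A') * B).trace + (L * (B * B' - B' * B)).trace)
        + y * ((r (g * A) * (g * A')).trace - (r (A * g) * (A' * g)).trace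
          + ((L * B - B * L) * (rPlus (B' * L) - rMinus (L * B'))).trace
          + ((g * A) * (rPlus (B' * L) - rMinus (L * B'))).trace
          - ((g * A') * (rPlus (B * L) - rMinus (L * B))).trace) := by
  have hs : ∀ X Y : Mat n, r (X - Y) = r X - r Y := (rLin n).map_sub
  have h1 := trace_r_mul (L * B) (L * B')
  have h2 := trace_r_mul (L * B) (B' * L)
  have h3 := trace_r_mul (B * L) (L * B')
  have h4 := trace_r_mul (B * L) (B' * L)
  have h5 := trace_r_mul (g * A) (L * B')
  have h6 := trace_r_mul (g * A) (B' * L)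
  simp only [bivector, rPlus, rMinus, momentum, r_add, hs, halfAnticomm]
  generalize r (L * B) = S₁ at *
  generalize r (B * L) = S₂ at *
  generalize r (L * B') = S₃ at *
  generalize r (B' * L) = S₄ at *
  generalize r (g * A) = S₅ at *
  simp only [mul_add, add_mul, mul_sub, sub_mul, smul_mul_assoc,
    mul_smul_comm, smul_add, smul_sub, trace_add, trace_sub, trace_smul, smul_eq_mul,
    mul_assoc] at *
  -- Every term is linear in the primed covector, so rotating its primed factor to the front is a
  -- normal form for the cyclic words.
  simp only [
    trace_rot₁' A', trace_rot₂ A', trace_rot₁' B', trace_rot₂ B', trace_rot₂' B', trace_rot₃ B',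
    trace_rot₂ S₃, trace_rot₂ S₄, mul_assoc] at *
  linear_combination y * (h1 - h2 - h3 + h4 + h5 - h6)

set_option maxHeartbeats 1000000 in
/-- The Schouten bracket of the bivector with itself vanishes. -/
theorem bivectorDeriv_cyclic (x y : ℂ) (g L A₁ B₁ A₂ B₂ A₃ B₃ : Mat n) :
    bivectorDeriv x y g L (hamVec₁ x y g L A₁ B₁) (hamVec₂ x y g L A₁ B₁) A₂ B₂ A₃ B₃
      + bivectorDeriv x y g L (hamVec₁ x y g L A₂ B₂) (hamVec₂ x y g L A₂ B₂) A₃ B₃ A₁ B₁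
      + bivectorDeriv x y g L (hamVec₁ x y g L A₃ B₃) (hamVec₂ x y g L A₃ B₃) A₁ B₁ A₂ B₂
      = 0 := by
  have hm := modified_yang_baxter (momentum g L A₁ B₁) (momentum g L A₂ B₂) (momentum g L A₃ B₃)
  have hw := modified_yang_baxter (A₁ * g) (A₂ * g) (A₃ * g)
  -- Skewness moves r off the differentiated factors, so that r acts only on the three momenta and
  -- the three Aᵢg; these values are then treated as free matrices.
  simp only [bivectorDeriv, hamVec₁, hamVec₂, trace_r_mul _ (momentum g L _ _),
    trace_r_mul _ (_ * g)]
  generalize r (momentum g L A₁ B₁) = R₁ at *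
  generalize r (momentum g L A₂ B₂) = R₂ at *
  generalize r (momentum g L A₃ B₃) = R₃ at *
  generalize r (A₁ * g) = Q₁ at *
  generalize r (A₂ * g) = Q₂ at *
  generalize r (A₃ * g) = Q₃ at *
  simp only [momentum, halfAnticomm, mul_add, add_mul, mul_sub, sub_mul, smul_mul_assoc,
    mul_smul_comm, smul_add, smul_sub, trace_add, trace_sub, trace_smul, smul_eq_mul,
    mul_assoc] at hm hw ⊢
  -- Each monomial contains exactly one of A₃, B₃, R₃, Q₃. Bringing it to the front makes cyclically
  -- equal words literally equal.
  simp only [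
    trace_rot₁' A₃, trace_rot₂' A₃, trace_rot₃ A₃, trace_rot₃' A₃, trace_rot₄ A₃, trace_rot₄'
    A₃, trace_rot₅ A₃, trace_rot₁' B₃, trace_rot₂' B₃, trace_rot₃ B₃, trace_rot₃' B₃, trace_rot₄
    B₃, trace_rot₄' B₃, trace_rot₅ B₃, trace_rot₁' R₃, trace_rot₂' R₃, trace_rot₃ R₃,
    trace_rot₃' R₃, trace_rot₄ R₃, trace_rot₁' Q₃, trace_rot₂' Q₃, trace_rot₃ Q₃, trace_rot₄ Q₃,
    mul_assoc] at hm hw ⊢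
  -- The r-free terms left by the anticommutators match the right-hand sides of the two Yang–Baxter
  -- equations; everything involving x cancels.
  linear_combination y ^ 2 * hm - y ^ 2 * hw

/-! ### Differentiating the bivector -/

section

open scoped Matrix.Norms.Operator

theorem hasDerivAt_r {f : ℂ → Mat n} {f' : Mat n} {t : ℂ} (hf : HasDerivAt f f' t) :
    HasDerivAt (fun s => r (f s)) (r f') t :=
  (rLin n).toContinuousLinearMap.hasFDerivAt.comp_hasDerivAt t hf

theorem hasDerivAt_trace {f : ℂ → Mat n} {f' : Mat n} {t : ℂ} (hf : HasDerivAt f f' t) :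
    HasDerivAt (fun s => (f s).trace) f'.trace t :=
  (Matrix.traceLinearMap (Fin n) ℂ ℂ).toContinuousLinearMap.hasFDerivAt.comp_hasDerivAt t hf

theorem hasDerivAt_momentum {g L A B : ℂ → Mat n} {g' L' A' B' : Mat n} {t : ℂ}
    (hg : HasDerivAt g g' t) (hL : HasDerivAt L L' t) (hA : HasDerivAt A A' t)
    (hB : HasDerivAt B B' t) :
    HasDerivAt (fun s => momentum (g s) (L s) (A s) (B s))
      (momentum g' L' (A t) (B t) + momentum (g t) (L t) A' B') t := by
  refine (((hg.fun_mul hA).fun_add (hL.fun_mul hB)).fun_sub (hB.fun_mul hL)).congr_deriv ?_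
  simp only [momentum]
  abel

theorem hasDerivAt_halfAnticomm (x y : ℂ) {L B : ℂ → Mat n} {L' B' : Mat n} {t : ℂ}
    (hL : HasDerivAt L L' t) (hB : HasDerivAt B B' t) :
    HasDerivAt (fun s => halfAnticomm x y (L s) (B s))
      ((y / 2) • (L' * B t + B t * L') + halfAnticomm x y (L t) B') t := by
  refine ((((hL.fun_mul hB).fun_add (hB.fun_mul hL)).fun_const_smul (y / 2)).fun_add
    (hB.fun_const_smul x)).congr_deriv ?_
  simp only [halfAnticomm, smul_add]
  abel

/-- Product rule: the bivector is linear in each covector, and `bivectorDeriv` collects the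
dependence on the base point. -/
theorem hasDerivAt_bivector (x y : ℂ) {g L A B C D : ℂ → Mat n} {g' L' A' B' C' D' : Mat n}
    {t : ℂ} (hg : HasDerivAt g g' t) (hL : HasDerivAt L L' t) (hA : HasDerivAt A A' t)
    (hB : HasDerivAt B B' t) (hC : HasDerivAt C C' t) (hD : HasDerivAt D D' t) :
    HasDerivAt (fun s => bivector x y (g s) (L s) (A s) (B s) (C s) (D s))
      (bivectorDeriv x y (g t) (L t) g' L' (A t) (B t) (C t) (D t)
        + bivector x y (g t) (L t) A' B' (C t) (D t)
        + bivector x y (g t) (L t) (A t) (B t) C' D') t := by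
  have h₁ := (hasDerivAt_trace ((hasDerivAt_r (hasDerivAt_momentum hg hL hA hB)).fun_mul
    (hasDerivAt_momentum hg hL hC hD))).const_mul y
  have h₂ := (hasDerivAt_trace ((hasDerivAt_r (hA.fun_mul hg)).fun_mul
    (hC.fun_mul hg))).const_mul y
  have h₃ := hasDerivAt_trace ((hg.fun_mul hA).fun_mul (hasDerivAt_halfAnticomm x y hL hD))
  have h₄ := hasDerivAt_trace ((hg.fun_mul hC).fun_mul (hasDerivAt_halfAnticomm x y hL hB))
  have h₅ := hasDerivAt_trace ((((hL.fun_mul hL).fun_const_smul (y / 2)).fun_add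
    (hL.fun_const_smul x)).fun_mul ((hB.fun_mul hD).fun_sub (hD.fun_mul hB)))
  refine ((((h₁.fun_sub h₂).fun_add h₃).fun_sub h₄).fun_add h₅).congr_deriv ?_
  simp only [bivector, bivectorDeriv, r_add, add_mul, mul_add, mul_sub,
    trace_add, trace_sub, smul_mul_assoc, mul_smul_comm, smul_add, trace_smul, smul_eq_mul]
  ring

theorem differentiableAt_r {E : Type*} [NormedAddCommGroup E] [NormedSpace ℂ E] {f : E → Mat n}
    {q : E} (hf : DifferentiableAt ℂ f q) : DifferentiableAt ℂ (fun s => r (f s)) q :=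
  (rLin n).toContinuousLinearMap.differentiableAt.comp q hf

theorem differentiableAt_trace {E : Type*} [NormedAddCommGroup E] [NormedSpace ℂ E]
    {f : E → Mat n} {q : E} (hf : DifferentiableAt ℂ f q) :
    DifferentiableAt ℂ (fun s => (f s).trace) q :=
  (Matrix.traceLinearMap (Fin n) ℂ ℂ).toContinuousLinearMap.differentiableAt.comp q hf

theorem differentiableAt_bivector (x y : ℂ) {E : Type*} [NormedAddCommGroup E] [NormedSpace ℂ E]
    {g L A B C D : E → Mat n} {q : E}
    (hg : DifferentiableAt ℂ g q) (hL : DifferentiableAt ℂ L q) (hA : DifferentiableAt ℂ A q)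
    (hB : DifferentiableAt ℂ B q) (hC : DifferentiableAt ℂ C q) (hD : DifferentiableAt ℂ D q) :
    DifferentiableAt ℂ (fun s => bivector x y (g s) (L s) (A s) (B s) (C s) (D s)) q := by
  have hm {A B : E → Mat n} (hA : DifferentiableAt ℂ A q) (hB : DifferentiableAt ℂ B q) :
      DifferentiableAt ℂ (fun s => momentum (g s) (L s) (A s) (B s)) q :=
    ((hg.fun_mul hA).fun_add (hL.fun_mul hB)).fun_sub (hB.fun_mul hL)
  have hs {B : E → Mat n} (hB : DifferentiableAt ℂ B q) :
      DifferentiableAt ℂ (fun s => halfAnticomm x y (L s) (B s)) q :=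
    (((hL.fun_mul hB).fun_add (hB.fun_mul hL)).fun_const_smul (y / 2)).fun_add
      (hB.fun_const_smul x)
  have h₁ := (differentiableAt_trace
    ((differentiableAt_r (hm hA hB)).fun_mul (hm hC hD))).const_mul y
  have h₂ := (differentiableAt_trace
    ((differentiableAt_r (hA.fun_mul hg)).fun_mul (hC.fun_mul hg))).const_mul y
  have h₃ := differentiableAt_trace ((hg.fun_mul hA).fun_mul (hs hD))
  have h₄ := differentiableAt_trace ((hg.fun_mul hC).fun_mul (hs hB))
  have h₅ := differentiableAt_trace ((((hL.fun_mul hL).fun_const_smul (y / 2)).fun_add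
    (hL.fun_const_smul x)).fun_mul ((hB.fun_mul hD).fun_sub (hD.fun_mul hB)))
  exact (((h₁.fun_sub h₂).fun_add h₃).fun_sub h₄).fun_add h₅

theorem hasDerivAt_matrix {f : ℂ → Mat n} {f' : Mat n} {t : ℂ}
    (h : ∀ i j, HasDerivAt (fun s => f s i j) (f' i j) t) : HasDerivAt f f' t :=
  hasDerivAt_pi.2 fun i => hasDerivAt_pi.2 fun j => h i j

theorem differentiableAt_matrix {E : Type*} [NormedAddCommGroup E] [NormedSpace ℂ E]
    {f : E → Mat n} {q : E} (h : ∀ i j, DifferentiableAt ℂ (fun s => f s i j) q) :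
    DifferentiableAt ℂ f q :=
  differentiableAt_pi.2 fun i => differentiableAt_pi.2 fun j => h i j

/-! ### The pencil for functions on open sets of matrix pairs -/

/-- The first component of a covector, as a matrix by means of the trace form. -/
def covec₁ (ℓ : Mat n × Mat n → ℂ) : Mat n := represent fun X => ℓ (X, 0)

/-- The second component of a covector, as a matrix by means of the trace form. -/
def covec₂ (ℓ : Mat n × Mat n → ℂ) : Mat n := represent fun X => ℓ (0, X)

theorem trace_covec (ℓ : Mat n × Mat n →L[ℂ] ℂ) (v : Mat n × Mat n) :
    (covec₁ ℓ * v.1).trace + (covec₂ ℓ * v.2).trace = ℓ v := by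
  have h₁ : (covec₁ ℓ * v.1).trace = ℓ (v.1, 0) :=
    pairing_represent (ℓ.toLinearMap ∘ₗ LinearMap.inl ℂ (Mat n) (Mat n)) v.1
  have h₂ : (covec₂ ℓ * v.2).trace = ℓ (0, v.2) :=
    pairing_represent (ℓ.toLinearMap ∘ₗ LinearMap.inr ℂ (Mat n) (Mat n)) v.2
  rw [h₁, h₂, ← map_add]
  simp

/-- The bracket of the pencil, for functions on an open subset of `gl(n, ℂ) × gl(n, ℂ)`. -/
def pencilBracket (x y : ℂ) (f h : Mat n × Mat n → ℂ) (q : Mat n × Mat n) : ℂ :=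
  bivector x y q.1 q.2 (covec₁ (fderiv ℂ f q)) (covec₂ (fderiv ℂ f q))
    (covec₁ (fderiv ℂ h q)) (covec₂ (fderiv ℂ h q))

/-- The Hamiltonian vector field of a function on an open subset of `gl(n, ℂ) × gl(n, ℂ)`. -/
def hamiltonianVec (x y : ℂ) (f : Mat n × Mat n → ℂ) (q : Mat n × Mat n) : Mat n × Mat n :=
  (hamVec₁ x y q.1 q.2 (covec₁ (fderiv ℂ f q)) (covec₂ (fderiv ℂ f q)),
    hamVec₂ x y q.1 q.2 (covec₁ (fderiv ℂ f q)) (covec₂ (fderiv ℂ f q)))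

/-- This form makes linearity and the Leibniz rule in the first argument inherited from the
derivative, and turns iterated brackets into derivatives along Hamiltonian vectors. -/
theorem pencilBracket_eq_fderiv (x y : ℂ) (f h : Mat n × Mat n → ℂ) (q : Mat n × Mat n) :
    pencilBracket x y f h q = fderiv ℂ f q (hamiltonianVec x y h q) := by
  rw [pencilBracket, bivector_eq_trace_hamVec, ← trace_covec]
  rfl

variable {f h k : Mat n × Mat n → ℂ} {U : Set (Mat n × Mat n)} {q : Mat n × Mat n}

theorem differentiableAt_pencilBracket (x y : ℂ) (hU : IsOpen U) (hf : DifferentiableOn ℂ f U)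
    (hh : DifferentiableOn ℂ h U) (hq : q ∈ U) :
    DifferentiableAt ℂ (pencilBracket x y f h) q :=
  differentiableAt_bivector x y differentiableAt_fst differentiableAt_snd
    (differentiableAt_matrix fun _ _ => differentiableAt_fderiv_apply hU hf hq _)
    (differentiableAt_matrix fun _ _ => differentiableAt_fderiv_apply hU hf hq _)
    (differentiableAt_matrix fun _ _ => differentiableAt_fderiv_apply hU hh hq _)
    (differentiableAt_matrix fun _ _ => differentiableAt_fderiv_apply hU hh hq _)

/-- For a constant direction v, symmetry of second derivatives identifies the v-derivative of the
covector df with the differential of the v-derivative of f. The last two terms are therefore again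
brackets. -/
theorem fderiv_pencilBracket (x y : ℂ) (hU : IsOpen U) (hf : DifferentiableOn ℂ f U)
    (hh : DifferentiableOn ℂ h U) (hq : q ∈ U) (v : Mat n × Mat n) :
    fderiv ℂ (pencilBracket x y f h) q v
      = bivectorDeriv x y q.1 q.2 v.1 v.2 (covec₁ (fderiv ℂ f q)) (covec₂ (fderiv ℂ f q))
          (covec₁ (fderiv ℂ h q)) (covec₂ (fderiv ℂ h q))
        + pencilBracket x y (fun p => fderiv ℂ f p v) h q
        + pencilBracket x y f (fun p => fderiv ℂ h p v) q := by
  have hγ : HasDerivAt (fun t : ℂ => q + t • v) v 0 :=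
    (((hasDerivAt_id (0 : ℂ)).smul_const v).const_add q).congr_deriv (one_smul ℂ v)
  have hγ0 : q + (0 : ℂ) • v = q := by simp
  have hcomp {φ : Mat n × Mat n → ℂ} (hφ : DifferentiableAt ℂ φ q) :
      HasDerivAt (fun t : ℂ => φ (q + t • v)) (fderiv ℂ φ q v) 0 :=
    HasFDerivAt.comp_hasDerivAt (0 : ℂ) (by rw [hγ0]; exact hφ.hasFDerivAt) hγ
  have hcov₁ {φ : Mat n × Mat n → ℂ} (hφ : DifferentiableOn ℂ φ U) :
      HasDerivAt (fun t : ℂ => covec₁ (fderiv ℂ φ (q + t • v)))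
        (covec₁ (fderiv ℂ (fun p => fderiv ℂ φ p v) q)) 0 :=
    hasDerivAt_matrix fun i j =>
      (hcomp (differentiableAt_fderiv_apply hU hφ hq (single j i 1, 0))).congr_deriv
        (fderiv_fderiv_apply_symm hU hφ hq _ _)
  have hcov₂ {φ : Mat n × Mat n → ℂ} (hφ : DifferentiableOn ℂ φ U) :
      HasDerivAt (fun t : ℂ => covec₂ (fderiv ℂ φ (q + t • v)))
        (covec₂ (fderiv ℂ (fun p => fderiv ℂ φ p v) q)) 0 :=
    hasDerivAt_matrix fun i j =>
      (hcomp (differentiableAt_fderiv_apply hU hφ hq (0, single j i 1))).congr_deriv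
        (fderiv_fderiv_apply_symm hU hφ hq _ _)
  have hγ₁ : HasDerivAt (fun t : ℂ => (q + t • v).1) v.1 0 :=
    (ContinuousLinearMap.fst ℂ (Mat n) (Mat n)).hasFDerivAt.comp_hasDerivAt (0 : ℂ) hγ
  have hγ₂ : HasDerivAt (fun t : ℂ => (q + t • v).2) v.2 0 :=
    (ContinuousLinearMap.snd ℂ (Mat n) (Mat n)).hasFDerivAt.comp_hasDerivAt (0 : ℂ) hγ
  have key := hasDerivAt_bivector x y hγ₁ hγ₂ (hcov₁ hf) (hcov₂ hf) (hcov₁ hh) (hcov₂ hh)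
  rw [(hcomp (differentiableAt_pencilBracket x y hU hf hh hq)).unique key]
  simp only [hγ0, pencilBracket]

end

theorem bivector_antisymm (x y : ℂ) (g L A B C D : Mat n) :
    bivector x y g L A B C D = -bivector x y g L C D A B := by
  simp only [bivector]
  rw [trace_r_mul, trace_r_mul, Matrix.trace_mul_comm (momentum g L A B),
    Matrix.trace_mul_comm (A * g), ← neg_sub (D * B)]
  simp only [mul_neg, trace_neg]
  ring

/-- The identity commutes with B, so the momentum does not vary; (LB + BL)/2 has derivative B and
L²/2 has derivative L. -/
theorem bivectorDeriv_shift (g L A B C D : Mat n) :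
    bivectorDeriv 0 1 g L 0 1 A B C D = bivector 1 0 g L A B C D := by
  have hr : r (0 : Mat n) = 0 := (rLin n).map_zero
  have h2 (X : Mat n) : X + X = (2 : ℂ) • X := (two_smul ℂ X).symm
  simp only [bivectorDeriv, bivector, momentum, halfAnticomm, zero_mul, mul_zero, mul_one, one_mul,
    zero_add, sub_self, hr, trace_zero, h2, smul_smul, zero_smul, add_zero, mul_smul_comm,
    smul_mul_assoc, trace_smul, smul_eq_mul, zero_div, one_smul, mul_sub, trace_sub]
  ring

/-! ### The brackets on the manifold -/

theorem coords_mem_domain (p : Phase n) : coords p ∈ domain n := p.1.isUnit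

theorem exists_coords_eq {q : Mat n × Mat n} (hq : q ∈ domain n) : ∃ p : Phase n, coords p = q :=
  ⟨(IsUnit.unit hq, q.2), rfl⟩

theorem extend_add (F G : Phase n → ℂ) : extend (F + G) = extend F + extend G := by
  ext q
  by_cases h : IsUnit q.1 <;> simp [extend, h]

theorem extend_mul (F G : Phase n → ℂ) : extend (F * G) = extend F * extend G := by
  ext q
  by_cases h : IsUnit q.1 <;> simp [extend, h]

theorem extend_smul (c : ℂ) (F : Phase n → ℂ) : extend (c • F) = c • extend F := by
  ext q
  by_cases h : IsUnit q.1 <;> simp [extend, h]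

section

open scoped Matrix.Norms.Operator

theorem trace_nabla1_mul {F : Phase n → ℂ} (hF : IsHolomorphic F) (p : Phase n) (X : Mat n) :
    (nabla1 F p * X).trace = fderiv ℂ (extend F) (coords p) (X * (p.1 : Mat n), 0) := by
  have h := hF.hasDerivAt_comp (γ := fun z : ℂ => (expGL (z • X) * p.1, p.2)) (z := 0)
    (((hasDerivAt_coe_expGL X).mul_const (p.1 : Mat n)).prodMk (hasDerivAt_const (0 : ℂ) p.2))
  simp only [expGL_zero, one_mul] at h
  exact (hasDerivAt_nabla1 hF p X).unique h

theorem trace_nabla1'_mul {F : Phase n → ℂ} (hF : IsHolomorphic F) (p : Phase n) (X : Mat n) :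
    (nabla1' F p * X).trace = fderiv ℂ (extend F) (coords p) ((p.1 : Mat n) * X, 0) := by
  have h := hF.hasDerivAt_comp (γ := fun z : ℂ => (p.1 * expGL (z • X), p.2)) (z := 0)
    (((hasDerivAt_coe_expGL X).const_mul (p.1 : Mat n)).prodMk (hasDerivAt_const (0 : ℂ) p.2))
  simp only [expGL_zero, mul_one] at h
  exact (hasDerivAt_nabla1' hF p X).unique h

theorem trace_d2_mul {F : Phase n → ℂ} (hF : IsHolomorphic F) (p : Phase n) (X : Mat n) :
    (d2 F p * X).trace = fderiv ℂ (extend F) (coords p) (0, X) := by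
  have h := hF.hasDerivAt_comp (γ := fun z : ℂ => (p.1, p.2 + z • X)) (z := 0)
    ((hasDerivAt_const (0 : ℂ) (p.1 : Mat n)).prodMk
      (((hasDerivAt_id (0 : ℂ)).smul_const X).const_add p.2))
  simp only [zero_smul, add_zero, one_smul] at h
  exact (hasDerivAt_d2 hF p X).unique h

theorem nabla1_eq {F : Phase n → ℂ} (hF : IsHolomorphic F) (p : Phase n) :
    nabla1 F p = (p.1 : Mat n) * covec₁ (fderiv ℂ (extend F) (coords p)) := by
  refine Matrix.ext_iff_trace_mul_right.2 fun X => ?_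
  rw [trace_nabla1_mul hF, ← trace_covec]
  simp only [mul_zero, trace_zero, add_zero]
  rw [mul_assoc, Matrix.trace_mul_comm (p.1 : Mat n), mul_assoc]

theorem nabla1'_eq {F : Phase n → ℂ} (hF : IsHolomorphic F) (p : Phase n) :
    nabla1' F p = covec₁ (fderiv ℂ (extend F) (coords p)) * (p.1 : Mat n) := by
  refine Matrix.ext_iff_trace_mul_right.2 fun X => ?_
  rw [trace_nabla1'_mul hF, ← trace_covec]
  simp only [mul_zero, trace_zero, add_zero, mul_assoc]

theorem d2_eq {F : Phase n → ℂ} (hF : IsHolomorphic F) (p : Phase n) :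
    d2 F p = covec₂ (fderiv ℂ (extend F) (coords p)) := by
  refine Matrix.ext_iff_trace_mul_right.2 fun X => ?_
  rw [trace_d2_mul hF, ← trace_covec]
  simp only [mul_zero, trace_zero, zero_add]

/-- The bracket `x { , }₁ + y { , }₂` of the pencil. -/
def pencil (x y : ℂ) (F H : Phase n → ℂ) : Phase n → ℂ := x • bracket1 F H + y • bracket2 F H

theorem pencil_apply (x y : ℂ) {F H : Phase n → ℂ} (hF : IsHolomorphic F) (hH : IsHolomorphic H)
    (p : Phase n) : pencil x y F H p = pencilBracket x y (extend F) (extend H) (coords p) := by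
  rw [pencilBracket, bivector_eq_brackets]
  simp only [pencil, Pi.add_apply, Pi.smul_apply, smul_eq_mul, bracket1, bracket2, pairing,
    nabla2, nabla2', nabla1_eq hF, nabla1_eq hH, nabla1'_eq hF, nabla1'_eq hH, d2_eq hF, d2_eq hH]
  rfl

variable {F G H : Phase n → ℂ}

theorem extend_pencil (x y : ℂ) (hF : IsHolomorphic F) (hH : IsHolomorphic H)
    {q : Mat n × Mat n} (hq : q ∈ domain n) :
    extend (pencil x y F H) q = pencilBracket x y (extend F) (extend H) q := by
  obtain ⟨p, rfl⟩ := exists_coords_eq hq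
  rw [extend_coords, pencil_apply x y hF hH]

theorem isHolomorphic_pencil (x y : ℂ) (hF : IsHolomorphic F) (hH : IsHolomorphic H) :
    IsHolomorphic (pencil x y F H) := by
  intro q hq
  refine DifferentiableWithinAt.congr
    (differentiableAt_pencilBracket x y (isOpen_domain n) hF hH hq).differentiableWithinAt
    (fun q' hq' => extend_pencil x y hF hH hq') (extend_pencil x y hF hH hq)

theorem fderiv_extend_pencil (x y : ℂ) (hF : IsHolomorphic F) (hH : IsHolomorphic H)
    {q : Mat n × Mat n} (hq : q ∈ domain n) :
    fderiv ℂ (extend (pencil x y F H)) q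
      = fderiv ℂ (pencilBracket x y (extend F) (extend H)) q :=
  Filter.EventuallyEq.fderiv_eq (Filter.eventuallyEq_of_mem ((isOpen_domain n).mem_nhds hq)
    fun _ hq' => extend_pencil x y hF hH hq')

theorem IsHolomorphic.differentiableAt (hF : IsHolomorphic F) (p : Phase n) :
    DifferentiableAt ℂ (extend F) (coords p) :=
  DifferentiableOn.differentiableAt hF ((isOpen_domain n).mem_nhds (coords_mem_domain p))

theorem pencilBracket_antisymm (x y : ℂ) (f h : Mat n × Mat n → ℂ) (q : Mat n × Mat n) :
    pencilBracket x y f h q = -pencilBracket x y h f q :=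
  bivector_antisymm x y _ _ _ _ _ _

/-- The outer bracket sees the inner one only through its derivative at q, so the values of `extend`
outside the open domain play no role. -/
theorem pencilBracket_pencil (x y : ℂ) (hG : IsHolomorphic G) (hH : IsHolomorphic H)
    (f : Mat n × Mat n → ℂ) {q : Mat n × Mat n} (hq : q ∈ domain n) :
    pencilBracket x y f (extend (pencil x y G H)) q
      = -pencilBracket x y (pencilBracket x y (extend G) (extend H)) f q := by
  rw [pencilBracket_antisymm, pencilBracket_eq_fderiv, pencilBracket_eq_fderiv,
    fderiv_extend_pencil x y hG hH hq]

/-- Each double bracket is the derivative of the inner bracket along a Hamiltonian vector frozen at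
q. It splits into a derivative of the bivector and two Hessian terms. The Hessian terms cancel in
pairs over the cyclic sum, leaving `bivectorDeriv_cyclic`. -/
theorem pencilBracket_jacobi (x y : ℂ) {U : Set (Mat n × Mat n)} (hU : IsOpen U)
    {f g h : Mat n × Mat n → ℂ} (hf : DifferentiableOn ℂ f U) (hg : DifferentiableOn ℂ g U)
    (hh : DifferentiableOn ℂ h U) {q : Mat n × Mat n} (hq : q ∈ U) :
    pencilBracket x y (pencilBracket x y g h) f q + pencilBracket x y (pencilBracket x y h f) g q
      + pencilBracket x y (pencilBracket x y f g) h q = 0 := by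
  have key {φ ψ : Mat n × Mat n → ℂ} (hφ : DifferentiableOn ℂ φ U) (hψ : DifferentiableOn ℂ ψ U)
      (χ : Mat n × Mat n → ℂ) : pencilBracket x y (pencilBracket x y φ ψ) χ q
        = bivectorDeriv x y q.1 q.2 (hamiltonianVec x y χ q).1 (hamiltonianVec x y χ q).2
            (covec₁ (fderiv ℂ φ q)) (covec₂ (fderiv ℂ φ q))
            (covec₁ (fderiv ℂ ψ q)) (covec₂ (fderiv ℂ ψ q))
          + fderiv ℂ (fun p => fderiv ℂ φ p (hamiltonianVec x y χ q)) q (hamiltonianVec x y ψ q)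
          - fderiv ℂ (fun p => fderiv ℂ ψ p (hamiltonianVec x y χ q)) q
              (hamiltonianVec x y φ q) := by
    rw [pencilBracket_eq_fderiv, fderiv_pencilBracket x y hU hφ hψ hq,
      pencilBracket_antisymm x y φ, pencilBracket_eq_fderiv, pencilBracket_eq_fderiv,
      sub_eq_add_neg]
  have symm {φ : Mat n × Mat n → ℂ} (hφ : DifferentiableOn ℂ φ U) (v w : Mat n × Mat n) :
      fderiv ℂ (fun p => fderiv ℂ φ p v) q w = fderiv ℂ (fun p => fderiv ℂ φ p w) q v :=
    fderiv_fderiv_apply_symm hU hφ hq v w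
  rw [key hg hh, key hh hf, key hf hg, symm hf (hamiltonianVec x y g q),
    symm hg (hamiltonianVec x y h q), symm hh (hamiltonianVec x y f q)]
  simp only [hamiltonianVec]
  linear_combination bivectorDeriv_cyclic x y q.1 q.2
    (covec₁ (fderiv ℂ f q)) (covec₂ (fderiv ℂ f q)) (covec₁ (fderiv ℂ g q))
    (covec₂ (fderiv ℂ g q)) (covec₁ (fderiv ℂ h q)) (covec₂ (fderiv ℂ h q))

theorem isPoissonBracket_pencil (n : ℕ) (x y : ℂ) : IsPoissonBracket (pencil (n := n) x y) where
  holomorphic F H hF hH := isHolomorphic_pencil x y hF hH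
  antisymm F H hF hH := by
    ext p
    rw [Pi.neg_apply, pencil_apply x y hF hH, pencil_apply x y hH hF, pencilBracket_antisymm]
  add_left F G H hF hG hH := by
    have hFG : IsHolomorphic (F + G) := by
      rw [IsHolomorphic, extend_add]
      exact DifferentiableOn.add hF hG
    ext p
    have e : fderiv ℂ (extend F + extend G) (coords p)
        = fderiv ℂ (extend F) (coords p) + fderiv ℂ (extend G) (coords p) :=
      fderiv_add (hF.differentiableAt p) (hG.differentiableAt p)
    rw [Pi.add_apply, pencil_apply x y hFG hH, pencil_apply x y hF hH, pencil_apply x y hG hH,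
      extend_add, pencilBracket_eq_fderiv, pencilBracket_eq_fderiv, pencilBracket_eq_fderiv, e]
    rfl
  smul_left c F H hF hH := by
    have hcF : IsHolomorphic (c • F) := by
      rw [IsHolomorphic, extend_smul]
      exact DifferentiableOn.const_smul hF c
    ext p
    have e : fderiv ℂ (c • extend F) (coords p) = c • fderiv ℂ (extend F) (coords p) :=
      fderiv_const_smul (hF.differentiableAt p) c
    rw [Pi.smul_apply, pencil_apply x y hcF hH, pencil_apply x y hF hH,
      extend_smul, pencilBracket_eq_fderiv, pencilBracket_eq_fderiv, e]
    rfl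
  leibniz F G H hF hG hH := by
    have hFG : IsHolomorphic (F * G) := by
      rw [IsHolomorphic, extend_mul]
      exact DifferentiableOn.mul hF hG
    ext p
    have e : fderiv ℂ (extend F * extend G) (coords p)
        = extend F (coords p) • fderiv ℂ (extend G) (coords p)
          + extend G (coords p) • fderiv ℂ (extend F) (coords p) :=
      fderiv_mul (hF.differentiableAt p) (hG.differentiableAt p)
    rw [Pi.add_apply, Pi.mul_apply, Pi.mul_apply, pencil_apply x y hFG hH, pencil_apply x y hF hH,
      pencil_apply x y hG hH, extend_mul, pencilBracket_eq_fderiv, pencilBracket_eq_fderiv,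
      pencilBracket_eq_fderiv, e]
    simp only [extend_coords, _root_.add_apply, _root_.smul_apply, smul_eq_mul]
    ring
  jacobi F G H hF hG hH := by
    ext p
    have hp := coords_mem_domain p
    simp only [Pi.add_apply, Pi.zero_apply]
    rw [pencil_apply x y hF (isHolomorphic_pencil x y hG hH),
      pencil_apply x y hG (isHolomorphic_pencil x y hH hF),
      pencil_apply x y hH (isHolomorphic_pencil x y hF hG),
      pencilBracket_pencil x y hG hH _ hp, pencilBracket_pencil x y hH hF _ hp,
      pencilBracket_pencil x y hF hG _ hp]
    linear_combination -pencilBracket_jacobi x y (isOpen_domain n) hF hG hH hp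

theorem bracket1_eq_pencil (F H : Phase n → ℂ) : bracket1 F H = pencil 1 0 F H := by
  simp [pencil]

theorem bracket2_eq_pencil (F H : Phase n → ℂ) : bracket2 F H = pencil 0 1 F H := by
  simp [pencil]

theorem compatible_brackets (n : ℕ) : Compatible (bracket1 (n := n)) bracket2 := by
  refine ⟨?_, ?_, isPoissonBracket_pencil n⟩
  · convert isPoissonBracket_pencil n 1 0 using 1
    ext F H : 2
    exact bracket1_eq_pencil F H
  · convert isPoissonBracket_pencil n 0 1 using 1
    ext F H : 2
    exact bracket2_eq_pencil F H

/-! ### The shift field and the Lie derivative -/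

theorem hasDerivAt_coords_shift (p : Phase n) (z : ℂ) :
    HasDerivAt (fun w => coords (shift w p)) ((0, 1) : Mat n × Mat n) z :=
  ((hasDerivAt_const z (p.1 : Mat n)).prodMk
    (((hasDerivAt_id z).smul_const (1 : Mat n)).const_add p.2)).congr_deriv (by simp)

theorem shift_zero (p : Phase n) : shift 0 p = p := by
  simp [shift]

/-- The velocity at time 0 of the curve starting at p determines W at p, which gives uniqueness as
well as existence. -/
theorem generatesShift_iff (W : Phase n → Mat n × Mat n) :
    GeneratesShift W ↔ W = fun _ => (0, 1) := by
  constructor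
  · rintro ⟨-, hW⟩
    ext1 p
    have h : W (shift 0 p) = (0, 1) := ((hW p).2 0).unique (hasDerivAt_coords_shift p 0)
    rwa [shift_zero] at h
  · rintro rfl
    refine ⟨?_, fun p => ⟨shift_zero p, hasDerivAt_coords_shift p⟩⟩
    intro q hq
    refine DifferentiableWithinAt.congr (differentiableWithinAt_const ((0, 1) : Mat n × Mat n))
      (fun q' hq' => ?_) ?_
    · exact dif_pos hq'
    · exact dif_pos hq

theorem extend_derivAlong_const (v : Mat n × Mat n) (F : Phase n → ℂ) {q : Mat n × Mat n}
    (hq : q ∈ domain n) :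
    extend (derivAlong (fun _ => v) F) q = fderiv ℂ (extend F) q v := by
  obtain ⟨p, rfl⟩ := exists_coords_eq hq
  rw [extend_coords, derivAlong]

theorem isHolomorphic_derivAlong_const (v : Mat n × Mat n) (hF : IsHolomorphic F) :
    IsHolomorphic (derivAlong (fun _ => v) F) := by
  intro q hq
  refine DifferentiableWithinAt.congr
    (differentiableAt_fderiv_apply (isOpen_domain n) hF hq v).differentiableWithinAt
    (fun q' hq' => extend_derivAlong_const v F hq') (extend_derivAlong_const v F hq)

theorem fderiv_extend_derivAlong_const (v : Mat n × Mat n) (F : Phase n → ℂ) {q : Mat n × Mat n}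
    (hq : q ∈ domain n) :
    fderiv ℂ (extend (derivAlong (fun _ => v) F)) q
      = fderiv ℂ (fun q' => fderiv ℂ (extend F) q' v) q :=
  Filter.EventuallyEq.fderiv_eq (Filter.eventuallyEq_of_mem ((isOpen_domain n).mem_nhds hq)
    fun _ hq' => extend_derivAlong_const v F hq')

/-- Since W is constant, the brackets with W[F] and W[H] cancel the terms in which the derivative
falls on the differentials. Only the derivative of the coefficients of the bivector survives. -/
theorem lieDerivBracket_bracket2 (hF : IsHolomorphic F) (hH : IsHolomorphic H) :
    lieDerivBracket (fun _ => (0, 1)) bracket2 F H = bracket1 F H := by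
  ext p
  have hp := coords_mem_domain p
  simp only [lieDerivBracket, bracket1_eq_pencil, bracket2_eq_pencil, Pi.sub_apply]
  rw [pencil_apply 0 1 (isHolomorphic_derivAlong_const _ hF) hH,
    pencil_apply 0 1 hF (isHolomorphic_derivAlong_const _ hH), pencil_apply 1 0 hF hH,
    derivAlong, fderiv_extend_pencil 0 1 hF hH hp,
    fderiv_pencilBracket 0 1 (isOpen_domain n) hF hH hp, bivectorDeriv_shift]
  simp only [pencilBracket, fderiv_extend_derivAlong_const _ _ hp]
  ring

end

end

end BiHam

theorem theorem2p2 (n : ℕ) :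
    (∃! W : BiHam.Phase n → BiHam.Mat n × BiHam.Mat n, BiHam.GeneratesShift W) ∧
    (∀ W : BiHam.Phase n → BiHam.Mat n × BiHam.Mat n, BiHam.GeneratesShift W →
      ∀ F H : BiHam.Phase n → ℂ, BiHam.IsHolomorphic F → BiHam.IsHolomorphic H →
        BiHam.lieDerivBracket W BiHam.bracket2 F H = BiHam.bracket1 F H) ∧
    BiHam.Compatible (BiHam.bracket1 (n := n)) BiHam.bracket2 := by
  refine ⟨⟨fun _ => (0, 1), (BiHam.generatesShift_iff _).2 rfl,
    fun W hW => (BiHam.generatesShift_iff W).1 hW⟩, fun W hW F H hF hH => ?_,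
    BiHam.compatible_brackets n⟩
  obtain rfl := (BiHam.generatesShift_iff W).1 hW
  exact BiHam.lieDerivBracket_bracket2 hF hH
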